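/- A server offloads the jobs of $N$ users to one machine in slotted time. While the machine is not executing a job of the server, it is either free or internally busy, and at the end of each slot it changes between these two states with probability $q\in(0,1]$. At the beginning of each slot in which the machine is not executing a job of the server, the server samples the state of the machine with probability $\bar\mu\in(0,1]$, at cost $L$; it does not sample while one of its own jobs is being executed. If the sampled state is free, the server immediately assigns to the machine a job of the scheduled user. A job of user $i$ that is being executed in a slot is completed at the end of that slot with probability $q_i\in(0,1]$; the machine then becomes internally busy with probability $s\in(0,1]$ and free with probability $1-s$. All these random experiments are independent. Let $\mathcal S$ be a non-empty set of users whose job queues all remain non-empty forever (whatever the arrivals are), and let the scheduled user always be the user in $\mathcal S$ with the largest age of job completion, i.e. with the largest time since the last completion of one of its jobs (ties broken by any fixed rule). With $\mu(t)$ the indicator that the server samples in slot $t$, the average sampling cost $S^{\bar\phi}(\mathcal S)=\limsup_{T\to\infty}\frac{L}{T}\sum_{t=1}^{T}\mathbb E[\mu(t)]$ is, for every initial state, $$S^{\bar\phi}(\mathcal S)=\frac{\bar\mu\,|\mathcal S|\,L}{|\mathcal S|\left((1-\bar\mu)+\frac{s\bar\mu}{q}+1\right)+\bar\mu\sum_{i\in\mathcal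 S}\frac{1-q_i}{q_i}}\left(p_1^*+\frac{(1-p_1^*)(1+p^*)}{p^*}\right),$$ where $p^*=\dfrac{q}{1-(1-2q)(1-\bar\mu)}$ and $p_1^*=s(1-\bar\mu)p^*+(1-s)\bigl(1-(1-\bar\mu)p^*\bigr)$. -/

import Mathlib

open Filter MeasureTheory ProbabilityTheory

/-- The actual state of the machine: internally busy, free, or executing a job of user `i`. -/
inductive Machine (N : ℕ) : Type
  | busy : Machine N
  | free : Machine N
  | job (i : Fin N) : Machine N

/-- The state of the system at the beginning of a slot, before the server acts: the state of the
machine, the slot of the last completed job of each user, and the queue lengths (an infinite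
backlog is allowed). A job stays in its queue until it is completed. -/
structure SysState (N : ℕ) : Type where
  machine : Machine N
  last : Fin N → ℤ
  queue : Fin N → ℕ∞

/-- The elementary random experiments of one slot: the sampling decision of the server, the
transition of the internal busy/free chain, the state of the machine after an external job
has been completed, and the completion of a job of user `i` that is being executed. -/
inductive Coin (N : ℕ) : Type
  | sample : Coin N
  | flip : Coin N
  | post : Coin N
  | done (i : Fin N) : Coin N

namespace SysState

variable {N : ℕ}

/-- Age of job completion of user `i` at slot `t`: the time since the last completion. -/
def age (x : SysState N) (t : ℕ) (i : Fin N) : ℤ := (t : ℤ) - x.last i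

/-- Whether the server samples the machine in this slot. The server knows when one of its
own jobs is being executed, and does not sample then. -/
def samples (x : SysState N) (c : Coin N → Bool) : Bool :=
  match x.machine with
  | .job _ => false
  | _ => c .sample

open Classical in
/-- The machine after the action of the server at the beginning of slot `t`: if the machine is
sampled and found free, it receives a job of the user that the scheduling rule `sel` selects from
the current ages, provided that the queue of this user is non-empty. -/
noncomputable def assigned (sel : (Fin N → ℤ) → Fin N) (t : ℕ) (x : SysState N)
    (c : Coin N → Bool) : Machine N :=
  match x.machine with
  | .busy => .busy
  | .job i => .job i
  | .free =>
    if c .sample = true ∧ 0 < x.queue (sel (x.age t)) then .job (sel (x.age t)) else .free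

/-- A job of user `i` is completed at the end of slot `t`. -/
def Completes (sel : (Fin N → ℤ) → Fin N) (t : ℕ) (x : SysState N) (c : Coin N → Bool)
    (i : Fin N) : Prop :=
  x.assigned sel t c = .job i ∧ c (.done i) = true

/-- The machine at the beginning of slot `t + 1`. -/
noncomputable def nextMachine (sel : (Fin N → ℤ) → Fin N) (t : ℕ) (x : SysState N)
    (c : Coin N → Bool) : Machine N :=
  match x.assigned sel t c with
  | .busy => if c .flip then .free else .busy
  | .free => if c .flip then .busy else .free
  | .job i => if c (.done i) then (if c .post then .busy else .free) else .job i

open Classical in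
/-- One slot of the system, with `a i` jobs of user `i` arriving at its end. -/
noncomputable def step (sel : (Fin N → ℤ) → Fin N) (t : ℕ) (x : SysState N)
    (c : Coin N → Bool) (a : Fin N → ℕ) : SysState N where
  machine := x.nextMachine sel t c
  last := fun i => if x.Completes sel t c i then (t : ℤ) else x.last i
  queue := fun i => (x.queue i - if x.Completes sel t c i then 1 else 0) + (a i : ℕ∞)

end SysState

/-- The state at the beginning of each of the slots `0, 1, 2, …`. -/
noncomputable def trajectory {N : ℕ} (sel : (Fin N → ℤ) → Fin N) (x₀ : SysState N)
    (c : ℕ → Coin N → Bool) (a : ℕ → Fin N → ℕ) : ℕ → SysState N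
  | 0 => x₀
  | t + 1 => (trajectory sel x₀ c a t).step sel t (c t) (a t)

/-- `sel` schedules a user of `S` whose age is maximal among the users of `S`
(ties are broken in an arbitrary way). -/
def IsMaxAgeRule {N : ℕ} (S : Finset (Fin N)) (sel : (Fin N → ℤ) → Fin N) : Prop :=
  ∀ v : Fin N → ℤ, sel v ∈ S ∧ ∀ j ∈ S, v j ≤ v (sel v)

/-- The success probabilities of the experiments: `μ` for sampling, `q` for a transition of the
symmetric internal chain, `s` for being internally busy after an external job, and `r i` for
the completion of a job of user `i` in a slot (so that service times are geometric). -/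
def coinProb {N : ℕ} (μ q s : ℝ) (r : Fin N → ℝ) : Coin N → ℝ
  | .sample => μ
  | .flip => q
  | .post => s
  | .done i => r i

/-- All experiments, over all slots, are independent and have their prescribed probabilities. -/
structure IsDriving {N : ℕ} {Ω : Type*} [MeasurableSpace Ω] (P : Measure Ω)
    (μ q s : ℝ) (r : Fin N → ℝ) (c : ℕ → Coin N → Ω → Bool) : Prop where
  measurable : ∀ t k, Measurable (c t k)
  law : ∀ t k, P {ω | c t k ω = true} = ENNReal.ofReal (coinProb μ q s r k)
  indep : iIndepFun (fun (tk : ℕ × Coin N) (ω : Ω) => c tk.1 tk.2 ω) P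

/-- The state of the random system at the beginning of slot `t`. -/
noncomputable def systemAt {N : ℕ} {Ω : Type*} (sel : (Fin N → ℤ) → Fin N) (x₀ : SysState N)
    (c : ℕ → Coin N → Ω → Bool) (a : ℕ → Fin N → Ω → ℕ) (t : ℕ) (ω : Ω) : SysState N :=
  trajectory sel x₀ (fun u k => c u k ω) (fun u i => a u i ω) t

/-- The indicator that the server samples in slot `t`. -/
noncomputable def sampling {N : ℕ} {Ω : Type*} (sel : (Fin N → ℤ) → Fin N) (x₀ : SysState N)
    (c : ℕ → Coin N → Ω → Bool) (a : ℕ → Fin N → Ω → ℕ) (t : ℕ) (ω : Ω) : ℝ :=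
  if (systemAt sel x₀ c a t ω).samples (fun k => c t k ω) then 1 else 0

/-- The average sampling cost, with a cost `L` for each sampling. -/
noncomputable def avgSamplingCost {N : ℕ} {Ω : Type*} [MeasurableSpace Ω] (P : Measure Ω)
    (L : ℝ) (sel : (Fin N → ℤ) → Fin N) (x₀ : SysState N)
    (c : ℕ → Coin N → Ω → Bool) (a : ℕ → Fin N → Ω → ℕ) : ℝ :=
  limsup (fun T : ℕ => L / (T : ℝ) * ∑ t ∈ Finset.range T, ∫ ω, sampling sel x₀ c a t ω ∂P) atTop

/-- `p* = q / (1 - (1 - 2q)(1 - μ))`. -/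
noncomputable def pStar (μ q : ℝ) : ℝ := q / (1 - (1 - 2 * q) * (1 - μ))

/-- `p₁* = s (1 - μ) p* + (1 - s) (1 - (1 - μ) p*)`. -/
noncomputable def pStarOne (μ q s : ℝ) : ℝ :=
  s * (1 - μ) * pStar μ q + (1 - s) * (1 - (1 - μ) * pStar μ q)

section Independence

variable {Ω : Type*} [MeasurableSpace Ω] {P : Measure Ω} [IsProbabilityMeasure P]

/-- Fubini for independent random variables with finitely many values. -/
theorem integral_eq_integral_integral_of_indepFun {α β : Type*} [Finite α] [Finite β]
    [MeasurableSpace α] [MeasurableSingletonClass α] [MeasurableSpace β]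
    [MeasurableSingletonClass β] {X : Ω → α} {Y : Ω → β} (hX : Measurable X) (hY : Measurable Y)
    (h : IndepFun X Y P) (H : α → β → ℝ) :
    ∫ ω, H (X ω) (Y ω) ∂P = ∫ ω, ∫ ω', H (X ω) (Y ω') ∂P ∂P := by
  have hmap := (indepFun_iff_map_prod_eq_prod_map_map hX.aemeasurable hY.aemeasurable).1 h
  have : IsProbabilityMeasure (P.map X) := Measure.isProbabilityMeasure_map hX.aemeasurable
  have : IsProbabilityMeasure (P.map Y) := Measure.isProbabilityMeasure_map hY.aemeasurable
  have key : ∫ ω, H (X ω) (Y ω) ∂P =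
      ∫ z, H z.1 z.2 ∂(P.map (fun ω => (X ω, Y ω))) :=
    (integral_map (hX.prodMk hY).aemeasurable
      (f := fun z : α × β => H z.1 z.2) (measurable_of_finite _).aestronglyMeasurable).symm
  rw [key, hmap, integral_prod (fun z : α × β => H z.1 z.2) Integrable.of_finite]
  rw [integral_map hX.aemeasurable (measurable_of_finite _).aestronglyMeasurable]
  refine integral_congr_ae (ae_of_all _ fun ω => ?_)
  exact integral_map hY.aemeasurable (measurable_of_finite _).aestronglyMeasurable

/-- The mean of a function of a Bernoulli variable. -/
theorem integral_comp_bool {p : ℝ} (hp : 0 ≤ p) {b : Ω → Bool} (hb : Measurable b)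
    (hlaw : P {ω | b ω = true} = ENNReal.ofReal p) (F : Bool → ℝ) :
    ∫ ω, F (b ω) ∂P = p * F true + (1 - p) * F false := by
  have hset : MeasurableSet {ω | b ω = true} := hb (measurableSet_singleton true)
  have hF : ∀ ω, F (b ω) =
      F false + {ω | b ω = true}.indicator (fun _ => F true - F false) ω := by
    intro ω
    cases hω : b ω <;> simp [hω]
  simp_rw [hF]
  rw [integral_add (integrable_const _) ((integrable_const _).indicator hset),
    integral_indicator_const _ hset, Measure.real, hlaw, ENNReal.toReal_ofReal hp]
  simp
  ring

end Independence

instance Coin.instFinite {N : ℕ} : Finite (Coin N) := by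
  refine Finite.of_injective (β := Option (Option (Option (Fin N))))
    (fun k => match k with
      | .sample => none
      | .flip => some none
      | .post => some (some none)
      | .done i => some (some (some i))) ?_
  intro k l h
  cases k <;> cases l <;> simp_all

namespace IsDriving

variable {N : ℕ} {Ω : Type*} [MeasurableSpace Ω] {P : Measure Ω}
  {μ q s : ℝ} {r : Fin N → ℝ} {c : ℕ → Coin N → Ω → Bool}

theorem measurable_slot (hc : IsDriving P μ q s r c) (t : ℕ) :
    Measurable fun ω k => c t k ω :=
  measurable_pi_lambda _ fun k => hc.measurable t k

open Classical in
/-- Averaging a function of the experiments of one slot over one of these experiments. -/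
theorem integral_slot [IsProbabilityMeasure P] (hc : IsDriving P μ q s r c) (t : ℕ) (k : Coin N)
    (hk : 0 ≤ coinProb μ q s r k) (G : (Coin N → Bool) → ℝ) :
    ∫ ω, G (fun j => c t j ω) ∂P =
      coinProb μ q s r k * ∫ ω, G (Function.update (fun j => c t j ω) k true) ∂P +
      (1 - coinProb μ q s r k) *
        ∫ ω, G (Function.update (fun j => c t j ω) k false) ∂P := by
  have := Fintype.ofFinite (Coin N)
  have hinj : Function.Injective fun j : Coin N => (t, j) := fun i j h => by simpa using h
  have hind : iIndepFun (fun (j : Coin N) (ω : Ω) => c t j ω) P := hc.indep.precomp hinj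
  have hfin := hind.indepFun_finset ({k}ᶜ : Finset (Coin N)) {k} disjoint_compl_left
    (fun j => hc.measurable t j)
  have hind2 : IndepFun (fun ω (j : ({k}ᶜ : Finset (Coin N))) => c t j ω) (c t k) P :=
    hfin.comp (φ := id) (ψ := fun y : ({k} : Finset (Coin N)) → Bool =>
      y ⟨k, Finset.mem_singleton_self k⟩) measurable_id (measurable_pi_apply _)
  let H : (({k}ᶜ : Finset (Coin N)) → Bool) → Bool → ℝ := fun z b =>
    G fun j => if h : j ∈ ({k}ᶜ : Finset (Coin N)) then z ⟨j, h⟩ else b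
  have hH : ∀ ω b, H (fun j => c t j ω) b = G (Function.update (fun j => c t j ω) k b) := by
    intro ω b
    simp only [H]
    congr 1
    funext j
    by_cases h : j = k <;> simp [h]
  have hX : Measurable fun ω (j : ({k}ᶜ : Finset (Coin N))) => c t j ω :=
    measurable_pi_lambda _ fun j => hc.measurable t j
  have hF := integral_eq_integral_integral_of_indepFun hX (hc.measurable t k) hind2 H
  have hself : ∀ ω, H (fun j => c t j ω) (c t k ω) = G fun j => c t j ω := by
    intro ω
    rw [hH, Function.update_eq_self k (fun j => c t j ω)]
  simp_rw [hself, integral_comp_bool hk (hc.measurable t k) (hc.law t k), hH] at hF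
  have hint : ∀ b, Integrable (fun ω => G (Function.update (fun j => c t j ω) k b)) P := by
    intro b
    refine Integrable.of_bound (C := ∑ z, |G z|) ?_ (ae_of_all _ fun ω => ?_)
    · exact ((measurable_of_finite fun z => G (Function.update z k b)).comp
        (hc.measurable_slot t)).aestronglyMeasurable
    · exact Finset.single_le_sum (f := fun z => |G z|) (fun z _ => abs_nonneg _)
        (Finset.mem_univ _)
  rw [hF, integral_add ((hint true).const_mul _) ((hint false).const_mul _),
    integral_const_mul, integral_const_mul]

end IsDriving

/-- The part of the state that does not involve the queues, together with the number of
completed jobs of each user. -/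
structure SaturatedState (N : ℕ) : Type where
  machine : Machine N
  last : Fin N → ℤ
  count : Fin N → ℕ

namespace SaturatedState

variable {N : ℕ}

/-- The machine after the action of the server, when the scheduled queue is non-empty. -/
def assigned (sel : (Fin N → ℤ) → Fin N) (t : ℕ) (x : SaturatedState N)
    (c : Coin N → Bool) : Machine N :=
  match x.machine with
  | .busy => .busy
  | .job i => .job i
  | .free => if c .sample then .job (sel fun i => (t : ℤ) - x.last i) else .free

/-- The state after a slot in which the machine is in state `m` after the server has acted. -/
def advance (t : ℕ) (x : SaturatedState N) (c : Coin N → Bool) (m : Machine N) :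
    SaturatedState N :=
  match m with
  | .busy => { x with machine := if c .flip then .free else .busy }
  | .free => { x with machine := if c .flip then .busy else .free }
  | .job i =>
    if c (.done i) then
      { machine := if c .post then .busy else .free
        last := Function.update x.last i t
        count := Function.update x.count i (x.count i + 1) }
    else { x with machine := .job i }

/-- One slot of the saturated system. -/
def step (sel : (Fin N → ℤ) → Fin N) (t : ℕ) (x : SaturatedState N) (c : Coin N → Bool) :
    SaturatedState N :=
  x.advance t c (x.assigned sel t c)

/-- The indicator that the server samples. -/
def sampleInd (x : SaturatedState N) (c : Coin N → Bool) : ℝ :=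
  match x.machine with
  | .job _ => 0
  | _ => if c .sample then 1 else 0

/-- The saturated system at the beginning of each slot. -/
def run (sel : (Fin N → ℤ) → Fin N) (x : SaturatedState N) (c : ℕ → Coin N → Bool) :
    ℕ → SaturatedState N
  | 0 => x
  | t + 1 => (run sel x c t).step sel t (c t)

theorem run_congr (sel : (Fin N → ℤ) → Fin N) (x : SaturatedState N)
    {c c' : ℕ → Coin N → Bool} {t : ℕ} (h : ∀ u < t, c u = c' u) :
    run sel x c t = run sel x c' t := by
  induction t with
  | zero => rfl
  | succ t ih =>
    simp only [run]
    rw [ih fun u hu => h u (by omega), h t (by omega)]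

/-- The invariant of the scheduling by maximal age: among the users of `S`, the numbers of
completed jobs are ordered as the last completions, and differ by at most one. -/
structure Balanced (S : Finset (Fin N)) (t : ℕ) (x : SaturatedState N) : Prop where
  last_lt : ∀ i, x.last i < t
  mono : ∀ i ∈ S, ∀ j ∈ S, x.last i ≤ x.last j → x.count i ≤ x.count j
  le_succ : ∀ i ∈ S, ∀ j ∈ S, x.count i ≤ x.count j + 1
  job_le : ∀ i ∈ S, x.machine = .job i → ∀ j ∈ S, x.count i ≤ x.count j

theorem Balanced.advance {S : Finset (Fin N)} {t : ℕ} {x : SaturatedState N}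
    (h : x.Balanced S t) (c : Coin N → Bool) (m : Machine N)
    (hm : ∀ i ∈ S, m = .job i → ∀ j ∈ S, x.count i ≤ x.count j) :
    (x.advance t c m).Balanced S (t + 1) := by
  have hlt : ∀ i, x.last i < ((t + 1 : ℕ) : ℤ) := fun i => by
    have := h.last_lt i; push_cast; omega
  cases m with
  | busy =>
    refine ⟨hlt, h.mono, h.le_succ, fun i hi hj => ?_⟩
    simp only [SaturatedState.advance] at hj
    split at hj <;> simp at hj
  | free =>
    refine ⟨hlt, h.mono, h.le_succ, fun i hi hj => ?_⟩
    simp only [SaturatedState.advance] at hj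
    split at hj <;> simp at hj
  | job k =>
    by_cases hd : c (.done k) = true
    · simp only [SaturatedState.advance, hd, if_true]
      refine ⟨fun i => ?_, fun i hi j hj hij => ?_, fun i hi j hj => ?_, fun i hi hmi => ?_⟩
      · by_cases hik : i = k
        · subst hik; simp
        · simpa [hik] using hlt i
      · by_cases hik : i = k
        · by_cases hjk : j = k
          · rw [hik, hjk]
          · have := h.last_lt j
            simp [hik, hjk] at hij
            omega
        · by_cases hjk : j = k
          · subst hjk
            simpa [hik] using h.le_succ i hi j hj
          · simp only [Function.update_of_ne hik, Function.update_of_ne hjk] at hij ⊢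
            exact h.mono i hi j hj hij
      · by_cases hik : i = k
        · by_cases hjk : j = k
          · rw [hik, hjk]; omega
          · subst hik
            simpa [hjk] using hm i hi rfl j hj
        · by_cases hjk : j = k
          · subst hjk
            have := h.le_succ i hi j hj
            simp [hik]; omega
          · simpa [hik, hjk] using h.le_succ i hi j hj
      · simp only at hmi
        split at hmi <;> simp at hmi
    · simp only [SaturatedState.advance, hd]
      refine ⟨hlt, h.mono, h.le_succ, fun i hi hmi => hm i hi hmi⟩

theorem Balanced.step {S : Finset (Fin N)} {sel : (Fin N → ℤ) → Fin N} (hsel : IsMaxAgeRule S sel)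
    {t : ℕ} {x : SaturatedState N} (h : x.Balanced S t) (c : Coin N → Bool) :
    (x.step sel t c).Balanced S (t + 1) := by
  refine h.advance c _ fun i hi hmi j hj => ?_
  rcases hx : x.machine with _ | _ | k
  · simp [assigned, hx] at hmi
  · simp only [assigned, hx] at hmi
    split at hmi
    · have hk : (sel fun i => (t : ℤ) - x.last i) = i := by simpa using hmi
      have hmax := (hsel fun i => (t : ℤ) - x.last i).2 j hj
      rw [hk] at hmax
      exact h.mono i hi j hj (by omega)
    · simp at hmi
  · simp only [assigned, hx] at hmi
    exact h.job_le i hi (by rw [hx, hmi]) j hj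

theorem Balanced.run {S : Finset (Fin N)} {sel : (Fin N → ℤ) → Fin N} (hsel : IsMaxAgeRule S sel)
    {x : SaturatedState N} (h : x.Balanced S 0) (c : ℕ → Coin N → Bool) (t : ℕ) :
    (x.run sel c t).Balanced S t := by
  induction t with
  | zero => exact h
  | succ t ih => exact ih.step hsel (c t)

/-- A weighted count of completed jobs is bounded if the weights are supported on `S` and sum
to zero. -/
theorem Balanced.abs_sum_le {S : Finset (Fin N)} {t : ℕ} {x : SaturatedState N}
    (h : x.Balanced S t) {D : Fin N → ℝ} (hD : ∀ i ∉ S, D i = 0) (hsum : ∑ i, D i = 0) :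
    |∑ i, (x.count i : ℝ) * D i| ≤ ∑ i, |D i| := by
  rcases S.eq_empty_or_nonempty with rfl | ⟨k, hk⟩
  · simp [hD]
  have heq : ∑ i, (x.count i : ℝ) * D i = ∑ i, ((x.count i : ℝ) - x.count k) * D i := by
    simp_rw [sub_mul]
    rw [Finset.sum_sub_distrib, ← Finset.mul_sum, hsum, mul_zero, sub_zero]
  rw [heq]
  refine (Finset.abs_sum_le_sum_abs _ _).trans (Finset.sum_le_sum fun i _ => ?_)
  by_cases hi : i ∈ S
  · rw [abs_mul]
    refine mul_le_of_le_one_left (abs_nonneg _) ?_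
    have h1 : (x.count i : ℝ) ≤ x.count k + 1 := by exact_mod_cast h.le_succ i hi k hk
    have h2 : (x.count k : ℝ) ≤ x.count i + 1 := by exact_mod_cast h.le_succ k hk i hi
    rw [abs_le]
    constructor <;> linarith
  · simp [hD i hi]

/-- The machine part of the solution of the Poisson equation. -/
noncomputable def machinePotential (s b g : ℝ) (r D : Fin N → ℝ) : Machine N → ℝ
  | .busy => b
  | .free => 0
  | .job i => s * b - g / r i - D i

/-- The solution of the Poisson equation of the saturated system. -/
noncomputable def potential (s b g : ℝ) (r D : Fin N → ℝ) (x : SaturatedState N) : ℝ :=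
  machinePotential s b g r D x.machine - ∑ i, (x.count i : ℝ) * D i

theorem sum_update_count (D : Fin N → ℝ) (n : Fin N → ℕ) (k : Fin N) :
    ∑ i, ((Function.update n k (n k + 1) i : ℕ) : ℝ) * D i = ∑ i, (n i : ℝ) * D i + D k := by
  rw [← Finset.add_sum_erase _ _ (Finset.mem_univ k),
    ← Finset.add_sum_erase _ (fun i => (n i : ℝ) * D i) (Finset.mem_univ k),
    Finset.sum_congr rfl fun i hi => by rw [Function.update_of_ne (Finset.ne_of_mem_erase hi)]]
  simp
  ring

theorem Balanced.abs_potential_le {S : Finset (Fin N)} {t : ℕ} {x : SaturatedState N}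
    (h : x.Balanced S t) (s b g : ℝ) (r : Fin N → ℝ) {D : Fin N → ℝ} (hD : ∀ i ∉ S, D i = 0)
    (hsum : ∑ i, D i = 0) :
    |potential s b g r D x| ≤ |b| + ∑ i, |s * b - g / r i - D i| + ∑ i, |D i| := by
  refine (abs_sub _ _).trans (add_le_add ?_ (h.abs_sum_le hD hsum))
  have hnn : 0 ≤ ∑ i, |s * b - g / r i - D i| := Finset.sum_nonneg fun i _ => abs_nonneg _
  rcases x.machine with _ | _ | k
  · simpa [machinePotential] using hnn
  · simp only [machinePotential, abs_zero]; positivity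
  · simp only [machinePotential]
    have := Finset.single_le_sum (f := fun i => |s * b - g / r i - D i|)
      (fun i _ => abs_nonneg _) (Finset.mem_univ k)
    have := abs_nonneg b
    linarith

/-- The Poisson equation of the saturated system. -/
theorem integral_poisson {S : Finset (Fin N)} {sel : (Fin N → ℤ) → Fin N}
    (hsel : IsMaxAgeRule S sel) {Ω : Type*} [MeasurableSpace Ω] {P : Measure Ω}
    [IsProbabilityMeasure P] {μ q s : ℝ} {r : Fin N → ℝ} {c : ℕ → Coin N → Ω → Bool}
    (hc : IsDriving P μ q s r c) (hμ : 0 ≤ μ) (hq : 0 ≤ q) (hs : 0 ≤ s) (hr : ∀ i, 0 < r i)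
    {b g : ℝ} {D : Fin N → ℝ} (hb : q * b = μ - g)
    (hD : ∀ i ∈ S, μ * D i = (μ - g) * (2 - μ) + μ * s * b - μ * g * ((1 - r i) / r i))
    (t : ℕ) (x : SaturatedState N) :
    ∫ ω, (potential s b g r D (x.step sel t fun k => c t k ω) - potential s b g r D x +
      x.sampleInd (fun k => c t k ω) - g) ∂P = 0 := by
  classical
  set G : (Coin N → Bool) → ℝ := fun y =>
    potential s b g r D (x.step sel t y) - potential s b g r D x + x.sampleInd y - g with hG
  change ∫ ω, G (fun k => c t k ω) ∂P = 0
  rcases hx : x.machine with _ | _ | i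
  · rw [hc.integral_slot t .flip hq G, hc.integral_slot t .sample hμ
        (fun y => G (Function.update y .flip true)), hc.integral_slot t .sample hμ
        (fun y => G (Function.update y .flip false))]
    simp [hG, step, advance, assigned, sampleInd, potential, machinePotential, hx, coinProb]
    linear_combination (-1 : ℝ) * hb
  · obtain ⟨i, hi, hiS⟩ : ∃ i, (sel fun i => (t : ℤ) - x.last i) = i ∧ i ∈ S :=
      ⟨_, rfl, (hsel _).1⟩
    have hri := (hr i).ne'
    have hDi := hD i hiS
    rw [hc.integral_slot t .sample hμ G, hc.integral_slot t .flip hq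
        (fun y => G (Function.update y .sample false)), hc.integral_slot t (.done i) (hr i).le
        (fun y => G (Function.update y .sample true)), hc.integral_slot t .post hs
        (fun y => G (Function.update (Function.update y (.done i) true) .sample true))]
    simp [hG, step, advance, assigned, sampleInd, potential, machinePotential, hx, hi, coinProb,
      sum_update_count]
    field_simp at hDi ⊢
    linear_combination (-1 : ℝ) * hDi + r i * (1 - μ) * hb
  · have hri := (hr i).ne'
    rw [hc.integral_slot t (.done i) (hr i).le G, hc.integral_slot t .post hs
        (fun y => G (Function.update y (.done i) true))]
    simp [hG, step, advance, assigned, sampleInd, potential, machinePotential, hx, coinProb,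
      sum_update_count]
    field_simp
    ring

end SaturatedState

namespace SaturatedState

variable {N : ℕ} {Ω : Type*} [MeasurableSpace Ω] {P : Measure Ω} {μ q s : ℝ} {r : Fin N → ℝ}
  {c : ℕ → Coin N → Ω → Bool}

/-- The state of the saturated system at the beginning of a slot is a function of finitely many
experiments, which are independent of those of this slot. -/
theorem exists_run_eq (hc : IsDriving P μ q s r c) (sel : (Fin N → ℤ) → Fin N)
    (x : SaturatedState N) (t : ℕ) :
    ∃ (A : Finset (ℕ × Coin N)) (R : (A → Bool) → SaturatedState N),
      IndepFun (fun ω (k : A) => c k.1.1 k.1.2 ω) (fun ω k => c t k ω) P ∧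
      ∀ ω, x.run sel (fun u k => c u k ω) t = R fun k => c k.1.1 k.1.2 ω := by
  classical
  have := Fintype.ofFinite (Coin N)
  refine ⟨Finset.range t ×ˢ Finset.univ, fun z => x.run sel (fun u k =>
    if h : (u, k) ∈ Finset.range t ×ˢ (Finset.univ : Finset (Coin N)) then z ⟨_, h⟩ else false) t,
    ?_, fun ω => run_congr sel x fun u hu => ?_⟩
  · have hdisj : Disjoint (Finset.range t ×ˢ (Finset.univ : Finset (Coin N)))
        (({t} : Finset ℕ) ×ˢ (Finset.univ : Finset (Coin N))) := by
      rw [Finset.disjoint_left]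
      rintro ⟨u, k⟩ h1 h2
      simp only [Finset.mem_product, Finset.mem_range, Finset.mem_singleton] at h1 h2
      omega
    exact (hc.indep.indepFun_finset _ _ hdisj fun k => hc.measurable k.1 k.2).comp (φ := id)
      (ψ := fun (y : (({t} : Finset ℕ) ×ˢ (Finset.univ : Finset (Coin N)) : Finset _) → Bool)
        (k : Coin N) => y ⟨(t, k), by simp⟩) measurable_id
      (measurable_pi_lambda _ fun k => measurable_pi_apply _)
  · funext k
    simp [hu]

theorem integrable_run [IsFiniteMeasure P] (hc : IsDriving P μ q s r c)
    (sel : (Fin N → ℤ) → Fin N) (x : SaturatedState N) (t : ℕ)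
    (F : SaturatedState N → (Coin N → Bool) → ℝ) :
    Integrable (fun ω => F (x.run sel (fun u k => c u k ω) t) fun k => c t k ω) P := by
  obtain ⟨A, R, -, hR⟩ := exists_run_eq hc sel x t
  simp_rw [hR]
  have hm : Measurable fun ω => ((fun k : A => c k.1.1 k.1.2 ω), (fun k => c t k ω)) :=
    (measurable_pi_lambda _ fun k => hc.measurable _ _).prodMk (hc.measurable_slot t)
  exact Integrable.comp_measurable (g := fun z : (A → Bool) × (Coin N → Bool) => F (R z.1) z.2)
    Integrable.of_finite hm

theorem integral_run [IsProbabilityMeasure P] (hc : IsDriving P μ q s r c)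
    (sel : (Fin N → ℤ) → Fin N) (x : SaturatedState N) (t : ℕ)
    (F : SaturatedState N → (Coin N → Bool) → ℝ) :
    ∫ ω, F (x.run sel (fun u k => c u k ω) t) (fun k => c t k ω) ∂P =
      ∫ ω, ∫ ω', F (x.run sel (fun u k => c u k ω) t) (fun k => c t k ω') ∂P ∂P := by
  obtain ⟨A, R, hind, hR⟩ := exists_run_eq hc sel x t
  simp_rw [hR]
  exact integral_eq_integral_integral_of_indepFun
    (measurable_pi_lambda _ fun k => hc.measurable _ _) (hc.measurable_slot t) hind
    fun z y => F (R z) y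

/-- The mean number of samplings of the saturated system up to a bounded error term. -/
theorem sum_integral_sampleInd [IsProbabilityMeasure P] {S : Finset (Fin N)}
    {sel : (Fin N → ℤ) → Fin N} (hsel : IsMaxAgeRule S sel) (hc : IsDriving P μ q s r c)
    (hμ : 0 ≤ μ) (hq : 0 ≤ q) (hs : 0 ≤ s) (hr : ∀ i, 0 < r i) {b g : ℝ} {D : Fin N → ℝ}
    (hb : q * b = μ - g)
    (hD : ∀ i ∈ S, μ * D i = (μ - g) * (2 - μ) + μ * s * b - μ * g * ((1 - r i) / r i))
    (x : SaturatedState N) (T : ℕ) :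
    ∑ t ∈ Finset.range T,
        ∫ ω, (x.run sel (fun u k => c u k ω) t).sampleInd (fun k => c t k ω) ∂P =
      g * T + potential s b g r D x -
        ∫ ω, potential s b g r D (x.run sel (fun u k => c u k ω) T) ∂P := by
  induction T with
  | zero => simp [run]
  | succ T ih =>
    have h := integral_run hc sel x T fun y z => potential s b g r D (y.step sel T z) -
      potential s b g r D y + y.sampleInd z - g
    simp_rw [integral_poisson hsel hc hμ hq hs hr hb hD T] at h
    have h1 := integrable_run hc sel x T fun y z => potential s b g r D (y.step sel T z)
    have h2 := integrable_run hc sel x T fun y _ => potential s b g r D y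
    have h3 := integrable_run hc sel x T fun y z => y.sampleInd z
    have h12 := integrable_run hc sel x T fun y z =>
      potential s b g r D (y.step sel T z) - potential s b g r D y
    have h123 := integrable_run hc sel x T fun y z =>
      potential s b g r D (y.step sel T z) - potential s b g r D y + y.sampleInd z
    rw [integral_sub h123 (integrable_const _), integral_add h12 h3, integral_sub h1 h2] at h
    rw [Finset.sum_range_succ, ih]
    simp only [run, integral_const, probReal_univ, smul_eq_mul, mul_zero] at h ⊢
    push_cast
    linarith

theorem tendsto_avg_sampleInd [IsProbabilityMeasure P] {S : Finset (Fin N)}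
    {sel : (Fin N → ℤ) → Fin N} (hsel : IsMaxAgeRule S sel) (hc : IsDriving P μ q s r c)
    (hμ : 0 ≤ μ) (hq : 0 ≤ q) (hs : 0 ≤ s) (hr : ∀ i, 0 < r i) {b g : ℝ} {D : Fin N → ℝ}
    (hb : q * b = μ - g)
    (hD : ∀ i ∈ S, μ * D i = (μ - g) * (2 - μ) + μ * s * b - μ * g * ((1 - r i) / r i))
    (hD0 : ∀ i ∉ S, D i = 0) (hsum : ∑ i, D i = 0)
    {x : SaturatedState N} (hx : x.Balanced S 0) (L : ℝ) :
    Tendsto (fun T : ℕ => L / (T : ℝ) * ∑ t ∈ Finset.range T,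
        ∫ ω, (x.run sel (fun u k => c u k ω) t).sampleInd (fun k => c t k ω) ∂P)
      atTop (nhds (L * g)) := by
  simp_rw [sum_integral_sampleInd hsel hc hμ hq hs hr hb hD x]
  set C : ℝ := |b| + ∑ i, |s * b - g / r i - D i| + ∑ i, |D i|
  set e : ℕ → ℝ := fun T => potential s b g r D x -
    ∫ ω, potential s b g r D (x.run sel (fun u k => c u k ω) T) ∂P with he
  have hbound : ∀ T, |e T| ≤ C + C := fun T => by
    refine (abs_sub _ _).trans (add_le_add (hx.abs_potential_le s b g r hD0 hsum) ?_)
    have := norm_integral_le_of_norm_le_const (μ := P) (C := C)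
      (f := fun ω => potential s b g r D (x.run sel (fun u k => c u k ω) T))
      (ae_of_all _ fun ω => (hx.run hsel _ T).abs_potential_le s b g r hD0 hsum)
    simpa using this
  have hzero : Tendsto (fun T : ℕ => (T : ℝ)⁻¹ * e T) atTop (nhds 0) :=
    tendsto_inv_atTop_nhds_zero_nat.zero_mul_isBoundedUnder_le
      (isBoundedUnder_of ⟨C + C, fun T => hbound T⟩)
  have hlim : Tendsto (fun T : ℕ => L * g + L * ((T : ℝ)⁻¹ * e T)) atTop (nhds (L * g)) := by
    simpa using tendsto_const_nhds.add (hzero.const_mul L)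
  refine hlim.congr' ?_
  filter_upwards [eventually_gt_atTop 0] with T hT
  have hT' : (T : ℝ) ≠ 0 := by positivity
  simp only [he]
  field_simp
  ring

end SaturatedState

/-- The state of the system without its queues, where no job has been completed yet. -/
def SysState.saturate {N : ℕ} (x : SysState N) : SaturatedState N :=
  ⟨x.machine, x.last, 0⟩

open SaturatedState in
/-- As long as the queues of the users of `S` are non-empty, the system and the saturated system
agree. -/
theorem trajectory_eq_run {N : ℕ} {S : Finset (Fin N)} {sel : (Fin N → ℤ) → Fin N}
    (hsel : IsMaxAgeRule S sel) (x₀ : SysState N) (c : ℕ → Coin N → Bool) (a : ℕ → Fin N → ℕ)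
    (h : ∀ t, ∀ i ∈ S, 0 < (trajectory sel x₀ c a t).queue i) (t : ℕ) :
    (trajectory sel x₀ c a t).machine = (x₀.saturate.run sel c t).machine ∧
      (trajectory sel x₀ c a t).last = (x₀.saturate.run sel c t).last := by
  induction t with
  | zero => exact ⟨rfl, rfl⟩
  | succ t ih =>
    have hqueue := h t
    simp only [trajectory, run]
    generalize trajectory sel x₀ c a t = x at ih hqueue ⊢
    generalize x₀.saturate.run sel c t = y at ih ⊢
    obtain ⟨hmach, hlast⟩ := ih
    have hass : x.assigned sel t (c t) = y.assigned sel t (c t) := by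
      have hage : x.age t = fun i => (t : ℤ) - y.last i := by
        funext i; rw [SysState.age, hlast]
      rcases hy : y.machine with _ | _ | k <;>
        simp [SysState.assigned, assigned, hmach, hy, hqueue _ (hsel _).1, hage]
    have hcomp : ∀ i, x.Completes sel t (c t) i ↔
        y.assigned sel t (c t) = .job i ∧ c t (.done i) = true := fun i => by
      rw [SysState.Completes, hass]
    simp only [SysState.step, SysState.nextMachine, SaturatedState.step, hass]
    generalize y.assigned sel t (c t) = m at hcomp
    rcases m with _ | _ | k
    · exact ⟨rfl, funext fun i => (if_neg (by simp [hcomp])).trans (congrFun hlast i)⟩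
    · exact ⟨rfl, funext fun i => (if_neg (by simp [hcomp])).trans (congrFun hlast i)⟩
    · by_cases hd : c t (.done k) = true
      · simp only [advance, hd, if_true, true_and]
        funext i
        by_cases hi : i = k
        · subst hi
          rw [if_pos ((hcomp i).2 ⟨rfl, hd⟩), Function.update_self]
        · have hik : Machine.job k ≠ .job i := fun h => hi (Machine.job.inj h).symm
          rw [if_neg (by simp [hcomp, hik]), Function.update_of_ne hi, hlast]
      · simp only [advance, hd, true_and, Bool.false_eq_true, if_false]
        refine funext fun i => (if_neg fun h => hd ?_).trans (congrFun hlast i)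
        obtain ⟨h1, h2⟩ := (hcomp i).1 h
        rwa [Machine.job.inj h1]

theorem sampling_eq_sampleInd {N : ℕ} {Ω : Type*} {S : Finset (Fin N)}
    {sel : (Fin N → ℤ) → Fin N} (hsel : IsMaxAgeRule S sel) (x₀ : SysState N)
    (c : ℕ → Coin N → Ω → Bool) (a : ℕ → Fin N → Ω → ℕ) {ω : Ω}
    (h : ∀ t, ∀ i ∈ S, 0 < (systemAt sel x₀ c a t ω).queue i) (t : ℕ) :
    sampling sel x₀ c a t ω =
      (x₀.saturate.run sel (fun u k => c u k ω) t).sampleInd fun k => c t k ω := by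
  have heq := (trajectory_eq_run hsel x₀ (fun u k => c u k ω) (fun u i => a u i ω) h t).1
  simp only [sampling, systemAt, SysState.samples, SaturatedState.sampleInd, heq]
  rcases (x₀.saturate.run sel (fun u k => c u k ω) t).machine with _ | _ | k <;> simp

theorem SysState.balanced_saturate {N : ℕ} (S : Finset (Fin N)) {x : SysState N}
    (hx : ∀ i, x.last i < 0) : x.saturate.Balanced S 0 :=
  ⟨fun i => by simpa [saturate] using hx i, by simp [saturate], by simp [saturate], by simp [saturate]⟩

/-- The mean number of samplings between two assignments. -/
theorem pStarOne_add_mul_div_pStar {μ q s : ℝ} (hμ : 0 < μ ∧ μ ≤ 1) (hq : 0 < q ∧ q ≤ 1) :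
    pStarOne μ q s + (1 - pStarOne μ q s) * (1 + pStar μ q) / pStar μ q =
      (1 - μ) + s * μ / q + 1 := by
  have hden : 1 - (1 - 2 * q) * (1 - μ) ≠ 0 := by
    nlinarith [mul_nonneg hq.1.le (sub_nonneg.2 hμ.2)]
  have hq' := hq.1.ne'
  unfold pStarOne pStar
  obtain ⟨d, hd⟩ : ∃ d, d = 1 - (1 - 2 * q) * (1 - μ) := ⟨_, rfl⟩
  rw [← hd] at hden ⊢
  field_simp
  rw [hd]
  ring

theorem theorem4 {N : ℕ} (S : Finset (Fin N)) (hS : S.Nonempty)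
    (μ q s L : ℝ) (r : Fin N → ℝ)
    (hμ : 0 < μ ∧ μ ≤ 1) (hq : 0 < q ∧ q ≤ 1) (hs : 0 < s ∧ s ≤ 1)
    (hr : ∀ i, 0 < r i ∧ r i ≤ 1)
    (sel : (Fin N → ℤ) → Fin N) (hsel : IsMaxAgeRule S sel)
    (x₀ : SysState N) (hx₀ : ∀ i, x₀.last i < 0)
    {Ω : Type*} [MeasurableSpace Ω] (P : Measure Ω) [IsProbabilityMeasure P]
    (c : ℕ → Coin N → Ω → Bool) (hc : IsDriving P μ q s r c)
    (a : ℕ → Fin N → Ω → ℕ) (ha : ∀ t i, Measurable (a t i))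
    (hbacklog : ∀ᵐ ω ∂P, ∀ t, ∀ i ∈ S, 0 < (systemAt sel x₀ c a t ω).queue i) :
    avgSamplingCost P L sel x₀ c a =
      μ * (S.card : ℝ) * L /
          ((S.card : ℝ) * ((1 - μ) + s * μ / q + 1) + μ * ∑ i ∈ S, (1 - r i) / r i) *
        (pStarOne μ q s + (1 - pStarOne μ q s) * (1 + pStar μ q) / pStar μ q) := by
  classical
  rw [pStarOne_add_mul_div_pStar hμ hq]
  set n : ℝ := (S.card : ℝ) with hn
  set W : ℝ := (1 - μ) + s * μ / q + 1 with hW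
  set ρ : ℝ := ∑ i ∈ S, (1 - r i) / r i with hρ
  have hμ0 := hμ.1
  have hq0 := hq.1
  have hs0 := hs.1
  have hn0 : 0 < n := Nat.cast_pos.2 hS.card_pos
  have hW0 : 0 < W := by
    have : 0 ≤ 1 - μ := sub_nonneg.2 hμ.2
    positivity
  have hρ0 : 0 ≤ ρ :=
    Finset.sum_nonneg fun i _ => div_nonneg (sub_nonneg.2 (hr i).2) (hr i).1.le
  have hden : 0 < n * W + μ * ρ := by positivity
  set g : ℝ := μ * n * W / (n * W + μ * ρ) with hg
  set b : ℝ := (μ - g) / q with hb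
  set D : Fin N → ℝ := fun i => if i ∈ S then
    ((μ - g) * (2 - μ) + μ * s * b) / μ - g * ((1 - r i) / r i) else 0 with hD
  have hlim := SaturatedState.tendsto_avg_sampleInd (D := D) (b := b) (g := g) hsel hc hμ0.le
    hq0.le hs0.le (fun i => (hr i).1) (by rw [hb]; field_simp)
    (fun i hi => by simp only [hD, hi, if_true]; field_simp) (fun i hi => by simp [hD, hi])
    (by
      have hgW : g * (n * W + μ * ρ) = μ * n * W := by rw [hg]; field_simp
      have hbW : (μ - g) * (2 - μ) + μ * s * b = (μ - g) * W := by
        rw [hb, hW]; field_simp; ring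
      simp only [hD]
      rw [Finset.sum_ite_mem, Finset.univ_inter, Finset.sum_sub_distrib, Finset.sum_const,
        ← Finset.mul_sum, nsmul_eq_mul, hbW, ← hn, ← hρ]
      field_simp
      linarith)
    (SysState.balanced_saturate S hx₀) L
  have hint : ∀ t, ∫ ω, sampling sel x₀ c a t ω ∂P =
      ∫ ω, (x₀.saturate.run sel (fun u k => c u k ω) t).sampleInd (fun k => c t k ω) ∂P := by
    intro t
    refine integral_congr_ae ?_
    filter_upwards [hbacklog] with ω hω
    exact sampling_eq_sampleInd hsel x₀ c a hω t
  unfold avgSamplingCost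
  simp_rw [hint]
  rw [hlim.limsup_eq, hg]
  ring
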